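/- For a finite simple graph $G$ with vertex set $V$, let $$P(G)=\{x\in[0,1]^V : x_i+x_j\le 1 \text{ for every edge } ij \text{ of } G\}$$ be its graph polytope, and let $\mathrm{vol}(G)$ be the $|V|$-dimensional Lebesgue volume of $P(G)$. For $n\ge 2$ let $C_n$ be the cycle on $n$ vertices $1,\dots,n$, with edges $\{i,i+1\}$, indices modulo $n$ (so $C_2$ is a single edge). Let $K(s,t)=1$ if $s+t\le 1$ and $K(s,t)=0$ otherwise, and let $T$ be the bounded operator on the real Hilbert space $L^2(0,1)$ given by $$(Tg)(t)=\int_0^1 K(t,s)\,g(s)\,ds .$$ **Theorem.** For every integer $n\ge 2$, the operator $T^n$ is of trace class with trace $$\operatorname{tr}(T^n)=\mathrm{vol}(C_n),$$ and $$\sum_{k\in\mathbb Z}\frac{1}{(4k+1)^n}=\frac{\pi^n\,\mathrm{vol}(C_n)}{2^n},$$ where the series converges absolutely. In particular, $\mathrm{vol}(C_3)=\frac14$ and $$\sum_{k\in\mathbb Z}\frac1{(4k+1)^3}=\sum_{m=0}^\infty\frac{(-1)^m}{(2m+1)^3}=\frac{\pi^3}{32},$$ and $\mathrm{vol}(C_4)=\frac16$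 and $$\sum_{k\in\mathbb Z}\frac1{(4k+1)^4}=\sum_{m=0}^\infty\frac{1}{(2m+1)^4}=\frac{\pi^4}{96}.$$ -/

import Mathlib

open MeasureTheory

/-- The graph polytope `P(G)`: the points `x` of the unit cube with `x i + x j ≤ 1` for every
edge `ij` of `G`. -/
def graphPolytope {V : Type*} (G : SimpleGraph V) : Set (V → ℝ) :=
  {x | (∀ i, x i ∈ Set.Icc (0 : ℝ) 1) ∧ ∀ i j, G.Adj i j → x i + x j ≤ 1}

/-- `vol(G)`: the Lebesgue volume of the graph polytope of `G`. -/
noncomputable def graphVolume {V : Type*} [Fintype V] (G : SimpleGraph V) : ℝ :=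
  (volume : Measure (V → ℝ)).real (graphPolytope G)

/-- The kernel `K(s, t)`, equal to `1` if `s + t ≤ 1` and to `0` elsewhere. -/
noncomputable def kernelK (s t : ℝ) : ℝ := if s + t ≤ 1 then 1 else 0

/-- Lebesgue measure on the interval `(0, 1)`. -/
noncomputable abbrev unitMeasure : Measure ℝ := volume.restrict (Set.Ioo (0 : ℝ) 1)

instance : IsProbabilityMeasure unitMeasure := ⟨by simp⟩

/-- The real Hilbert space `L²(0, 1)`. -/
abbrev L2Unit : Type := Lp ℝ 2 unitMeasure

/-- The function `t ↦ ∫₀¹ K(t, s) g(s) ds`. -/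
noncomputable def kernelIntegral (g : ℝ → ℝ) (t : ℝ) : ℝ := ∫ s, kernelK t s * g s ∂unitMeasure

theorem measurable_kernelK : Measurable (Function.uncurry kernelK) :=
  Measurable.ite (measurableSet_le (by fun_prop) (by fun_prop)) measurable_const measurable_const

theorem abs_kernelK_le (s t : ℝ) : |kernelK s t| ≤ 1 := by
  unfold kernelK; split_ifs <;> simp

theorem integrable_coe (g : L2Unit) : Integrable (g : ℝ → ℝ) unitMeasure :=
  (Lp.memLp g).integrable (by norm_num)

theorem integrable_kernel_mul (g : L2Unit) (t : ℝ) :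
    Integrable (fun s => kernelK t s * g s) unitMeasure :=
  (integrable_coe g).bdd_mul (c := 1)
    (measurable_kernelK.comp measurable_prodMk_left).aestronglyMeasurable
    (Filter.Eventually.of_forall fun s => abs_kernelK_le t s)

theorem abs_kernelIntegral_le (g : L2Unit) (t : ℝ) : |kernelIntegral g t| ≤ ‖g‖ := by
  have h1 : |kernelIntegral g t| ≤ ∫ s, |g s| ∂unitMeasure := by
    refine (abs_integral_le_integral_abs).trans
      (integral_mono (integrable_kernel_mul g t).abs (integrable_coe g).abs fun s => ?_)
    simp only [abs_mul]
    exact mul_le_of_le_one_left (abs_nonneg _) (abs_kernelK_le t s)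
  have h2 : ∫ s, |g s| ∂unitMeasure = (eLpNorm g 1 unitMeasure).toReal := by
    rw [eLpNorm_one_eq_lintegral_enorm]
    exact integral_norm_eq_lintegral_enorm (integrable_coe g).1
  rw [h2] at h1
  refine h1.trans ?_
  rw [Lp.norm_def]
  exact ENNReal.toReal_mono (Lp.eLpNorm_ne_top g)
    (eLpNorm_le_eLpNorm_of_exponent_le (by norm_num) (Lp.aestronglyMeasurable g))

theorem memLp_kernelIntegral (g : L2Unit) : MemLp (kernelIntegral g) 2 unitMeasure := by
  refine MemLp.of_bound (StronglyMeasurable.aestronglyMeasurable ?_) ‖g‖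
    (Filter.Eventually.of_forall fun t => abs_kernelIntegral_le g t)
  have hg : StronglyMeasurable (fun p : ℝ × ℝ => (g : ℝ → ℝ) p.2) :=
    (Lp.stronglyMeasurable g).comp_measurable measurable_snd
  exact (measurable_kernelK.stronglyMeasurable.mul hg).integral_prod_right

theorem kernelIntegral_congr {f g : ℝ → ℝ} (h : f =ᵐ[unitMeasure] g) :
    kernelIntegral f = kernelIntegral g := by
  funext t
  exact integral_congr_ae (h.mono fun s hs => by simp only [hs])

/-- The bounded operator `T` on `L²(0, 1)` with kernel `K`, `(T g)(t) = ∫₀¹ K(t, s) g(s) ds`. -/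
noncomputable def opT : L2Unit →L[ℝ] L2Unit :=
  LinearMap.mkContinuous
    { toFun := fun g => (memLp_kernelIntegral g).toLp (kernelIntegral g)
      map_add' := fun f g => by
        rw [← MemLp.toLp_add]
        refine MemLp.toLp_congr _ _ (Filter.EventuallyEq.of_eq ?_)
        rw [kernelIntegral_congr (Lp.coeFn_add f g)]
        funext t
        simp only [kernelIntegral, Pi.add_apply, mul_add]
        exact integral_add (integrable_kernel_mul f t) (integrable_kernel_mul g t)
      map_smul' := fun c g => by
        rw [RingHom.id_apply, ← MemLp.toLp_const_smul]
        refine MemLp.toLp_congr _ _ (Filter.EventuallyEq.of_eq ?_)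
        rw [kernelIntegral_congr (Lp.coeFn_smul c g)]
        funext t
        simp only [kernelIntegral, Pi.smul_apply, smul_eq_mul, mul_left_comm _ c]
        exact integral_const_mul c _ }
    1 fun g => by
      refine (Lp.norm_le_of_ae_bound (norm_nonneg g) (C := ‖g‖) ?_).trans_eq ?_
      · filter_upwards [(memLp_kernelIntegral g).coeFn_toLp] with t ht
        exact (congrArg norm ht).trans_le (abs_kernelIntegral_le g t)
      · have h : measureUnivNNReal unitMeasure = 1 := by simp [measureUnivNNReal]
        rw [h]
        simp

theorem opT_apply_ae (g : L2Unit) :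
    ∀ᵐ t ∂unitMeasure, opT g t = ∫ s, kernelK t s * g s ∂unitMeasure :=
  (memLp_kernelIntegral g).coeFn_toLp

/-- A bounded operator `A` on a Hilbert space is of trace class if its absolute value `P = |A|`,
the positive operator with `P² = A* A`, has finite trace: the series `∑ ⟨b i, P (b i)⟩`
converges for every orthonormal basis `b`. -/
def IsTraceClass {H : Type*} [NormedAddCommGroup H] [InnerProductSpace ℝ H] [CompleteSpace H]
    (A : H →L[ℝ] H) : Prop :=
  ∃ P : H →L[ℝ] H, P.IsPositive ∧ P * P = ContinuousLinearMap.adjoint A * A ∧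
    ∀ (s : Set H) (b : HilbertBasis s ℝ H), Summable fun i => inner ℝ (b i) (P (b i))

/-- `A` is of trace class and its trace, computed in any orthonormal basis, is `τ`. -/
def HasTrace {H : Type*} [NormedAddCommGroup H] [InnerProductSpace ℝ H] [CompleteSpace H]
    (A : H →L[ℝ] H) (τ : ℝ) : Prop :=
  IsTraceClass A ∧
    ∀ (s : Set H) (b : HilbertBasis s ℝ H), HasSum (fun i => inner ℝ (b i) (A (b i))) τ

/-! With ω = (4k+1)π/2, the functions √2 cos(ωt) are orthonormal eigenfunctions of `opT` with
eigenvalues 1/ω. Completeness follows from a Hilbert–Schmidt count: by ζ(2), the squares of these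
eigenvalues already sum to 1/2, the squared L² norm of K. A unit vector g orthogonal to all
eigenfunctions would add ‖Tg‖² to that sum (`sum_eigenvalueT_sq_le`), so Tg = 0, and T is injective
(`eq_zero_of_opT_eq_zero`).

For n ≥ 2 the powers λₖⁿ are absolutely summable, so Tⁿ is of trace class with trace ∑ λₖⁿ
(`HilbertBasis.hasTrace_of_eigen`). The kernel of Tⁿ has a pointwise eigenfunction expansion
(`hasSum_iteratedKernel`), so its integral over the diagonal is the same sum. By Fubini that
integral is the measure of closed n-step paths with consecutive sums at most 1, which is vol(Cₙ)
(`graphVolume_cycleGraph`). The volumes for n = 3, 4 are read off from the known values of the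
series. -/

section EigenBasis

/-! ### Operators diagonal in a Hilbert basis, and their trace -/

variable {ι H : Type*} [NormedAddCommGroup H] [InnerProductSpace ℝ H]

theorem HilbertBasis.hasSum_inner_apply_of_eigen (φ : HilbertBasis ι ℝ H) {A : H →L[ℝ] H}
    {c : ι → ℝ} (hA : ∀ k, A (φ k) = c k • φ k) (x y : H) :
    HasSum (fun k => c k * (inner ℝ (φ k) x * inner ℝ (φ k) y)) (inner ℝ x (A y)) := by
  have h := ((φ.hasSum_repr y).mapL A).mapL (innerSL ℝ x)
  refine h.congr_fun fun k => ?_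
  simp only [map_smul, hA, innerSL_apply_apply, φ.repr_apply_apply, smul_eq_mul]
  rw [real_inner_comm x]
  ring

theorem HilbertBasis.inner_apply_comm_of_eigen (φ : HilbertBasis ι ℝ H) {A : H →L[ℝ] H}
    {c : ι → ℝ} (hA : ∀ k, A (φ k) = c k • φ k) (x y : H) :
    inner ℝ (A x) y = inner ℝ x (A y) := by
  rw [real_inner_comm]
  refine (φ.hasSum_inner_apply_of_eigen hA y x).unique ?_
  refine (φ.hasSum_inner_apply_of_eigen hA x y).congr_fun fun k => ?_
  ring

theorem HilbertBasis.ext_of_apply_eq (φ : HilbertBasis ι ℝ H) {A B : H →L[ℝ] H}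
    (h : ∀ k, A (φ k) = B (φ k)) : A = B :=
  ContinuousLinearMap.ext_on (Submodule.dense_iff_topologicalClosure_eq_top.2 φ.dense_span) <| by
    rintro _ ⟨k, rfl⟩
    exact h k

/-- The double family cₖ⟨φₖ, bᵢ⟩² is absolutely summable by Parseval for `b`. Summing over i first
gives ∑ cₖ; summing over k first gives the diagonal entries of `A` in `b`. -/
theorem HilbertBasis.hasSum_inner_self_of_eigen (φ : HilbertBasis ι ℝ H) {A : H →L[ℝ] H}
    {c : ι → ℝ} (hA : ∀ k, A (φ k) = c k • φ k) (hc : Summable fun k => |c k|) {τ : ℝ}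
    (hτ : HasSum c τ) {κ : Type*} (b : HilbertBasis κ ℝ H) :
    HasSum (fun i => inner ℝ (b i) (A (b i))) τ := by
  have hb : ∀ k, HasSum (fun i => inner ℝ (φ k) (b i) * inner ℝ (φ k) (b i)) 1 := fun k => by
    have h := b.hasSum_inner_mul_inner (φ k) (φ k)
    rw [real_inner_self_eq_norm_sq, φ.orthonormal.1 k, one_pow] at h
    refine h.congr_fun fun i => ?_
    rw [real_inner_comm (φ k) (b i)]
  let f : ι × κ → ℝ := fun p => c p.1 * (inner ℝ (φ p.1) (b p.2) * inner ℝ (φ p.1) (b p.2))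
  have hf : Summable f := by
    have hfn : ∀ p, ‖f p‖ = |c p.1| * (inner ℝ (φ p.1) (b p.2) * inner ℝ (φ p.1) (b p.2)) :=
      fun p => by
        simp only [f, Real.norm_eq_abs]
        rw [abs_mul, abs_of_nonneg (mul_self_nonneg (inner ℝ (φ p.1) (b p.2)))]
    refine Summable.of_norm ((summable_prod_of_nonneg fun p => norm_nonneg (f p)).2 ⟨?_, ?_⟩)
    · intro k
      simp only [hfn]
      exact (hb k).summable.mul_left _
    · simp only [hfn, tsum_mul_left, (hb _).tsum_eq, mul_one]
      exact hc
  obtain ⟨a, ha⟩ := hf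
  have h1 : HasSum c a := ha.prod_fiberwise fun k => by simpa using (hb k).mul_left (c k)
  rw [hτ.unique h1]
  have h2 : HasSum (f ∘ Prod.swap) a := (Equiv.prodComm κ ι).hasSum_iff.2 ha
  exact h2.prod_fiberwise fun i => φ.hasSum_inner_apply_of_eigen hA (b i) (b i)

variable [CompleteSpace H]

/-- The operator which is diagonal in the Hilbert basis `φ` with summable entries `c`. -/
theorem HilbertBasis.exists_diagonal (φ : HilbertBasis ι ℝ H) {c : ι → ℝ}
    (hc : Summable fun k => |c k|) : ∃ P : H →L[ℝ] H, ∀ k, P (φ k) = c k • φ k := by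
  let R : ι → H →L[ℝ] H := fun k => c k • InnerProductSpace.rankOne ℝ (φ k) (φ k)
  have hR : Summable R := by
    refine Summable.of_norm (hc.congr fun k => ?_)
    simp only [R, norm_smul, InnerProductSpace.norm_rankOne, φ.orthonormal.1 k, mul_one,
      Real.norm_eq_abs]
  refine ⟨∑' k, R k, fun j => ?_⟩
  have h : HasSum (fun k => R k (φ j)) ((∑' k, R k) (φ j)) :=
    hR.hasSum.mapL (ContinuousLinearMap.apply ℝ H (φ j))
  refine h.unique ?_
  have hj : R j (φ j) = c j • φ j := by
    simp [R, InnerProductSpace.rankOne_apply, φ.orthonormal.1 j]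
  rw [← hj]
  refine hasSum_single j fun k hk => ?_
  simp [R, InnerProductSpace.rankOne_apply, φ.orthonormal.2 hk]

/-- An operator with an orthonormal eigenbasis and absolutely summable eigenvalues is of trace
class, and its trace is the sum of the eigenvalues. -/
theorem HilbertBasis.hasTrace_of_eigen (φ : HilbertBasis ι ℝ H) {A : H →L[ℝ] H}
    {c : ι → ℝ} (hA : ∀ k, A (φ k) = c k • φ k) (hc : Summable fun k => |c k|) {τ : ℝ}
    (hτ : HasSum c τ) : HasTrace A τ := by
  have hc' : Summable fun k => |(|c k|)| := by simpa using hc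
  -- `P` is |A|: `A` is self-adjoint and diagonal, so its absolute value has entries |cₖ|.
  obtain ⟨P, hP⟩ := φ.exists_diagonal hc'
  refine ⟨⟨P, ?_, ?_, fun s b => ?_⟩, fun s b => φ.hasSum_inner_self_of_eigen hA hc hτ b⟩
  · refine (ContinuousLinearMap.isPositive_iff P).2 ⟨fun x y => φ.inner_apply_comm_of_eigen hP x y,
      fun x => ?_⟩
    rw [φ.inner_apply_comm_of_eigen hP]
    exact (φ.hasSum_inner_apply_of_eigen hP x x).nonneg fun k =>
      mul_nonneg (abs_nonneg _) (mul_self_nonneg _)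
  · have hadj : ContinuousLinearMap.adjoint A = A :=
      ((ContinuousLinearMap.eq_adjoint_iff A A).2 fun x y =>
        φ.inner_apply_comm_of_eigen hA x y).symm
    refine φ.ext_of_apply_eq fun k => ?_
    rw [hadj]
    change P (P (φ k)) = A (A (φ k))
    simp only [hP, hA, map_smul, smul_smul, abs_mul_abs_self]
  · exact (φ.hasSum_inner_self_of_eigen hP hc' hc.hasSum b).summable

end EigenBasis

/-! ### Series over the odd integers -/

theorem four_mul_int_add_one_ne_zero (k : ℤ) : 4 * (k : ℝ) + 1 ≠ 0 := by
  have h : 4 * k + 1 ≠ 0 := by omega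
  exact_mod_cast h

/-- The numbers `4 k + 1`, `k ∈ ℤ`, are the odd positive integers with alternating signs. -/
theorem four_mul_int_add_one_eq (k : ℤ) :
    4 * (k : ℝ) + 1 = (-1) ^ Equiv.intEquivNat k * (2 * (Equiv.intEquivNat k : ℝ) + 1) := by
  -- `Equiv.intEquivNat` interleaves: k ≥ 0 goes to 2k and -(k+1) to 2k+1, so the parity of the
  -- image records the sign of 4k+1.
  rcases k with k | k
  · have h : Equiv.intEquivNat (Int.ofNat k) = 2 * k := rfl
    rw [h, pow_mul]
    push_cast
    norm_num
    ring
  · have h : Equiv.intEquivNat (Int.negSucc k) = 2 * k + 1 := rfl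
    rw [h, pow_succ, pow_mul, Int.negSucc_eq]
    push_cast
    norm_num
    ring

theorem hasSum_one_div_four_mul_int_add_one_pow_iff (n : ℕ) (a : ℝ) :
    HasSum (fun k : ℤ => 1 / (4 * (k : ℝ) + 1) ^ n) a ↔
      HasSum (fun m : ℕ => ((-1 : ℝ) ^ n) ^ m / (2 * (m : ℝ) + 1) ^ n) a := by
  rw [← Equiv.intEquivNat.hasSum_iff]
  refine iff_of_eq (congrArg (HasSum · a ) (funext fun k => ?_))
  simp only [Function.comp_apply]
  rw [four_mul_int_add_one_eq k, mul_pow, ← pow_mul, ← pow_mul, mul_comm n]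
  set j := Equiv.intEquivNat k * n
  have h : ((-1 : ℝ) ^ j) * (-1) ^ j = 1 := by rw [← mul_pow]; simp
  rw [div_mul_eq_div_div, ← eq_one_div_of_mul_eq_one_left h]

/-- The even terms are the full series scaled by 2⁻ⁿ; the rest is the odd part. For n ≥ 1 the term m
= 0 is 1/0 = 0. -/
theorem HasSum.odd_of_one_div_pow {n : ℕ} {a : ℝ}
    (h : HasSum (fun m : ℕ => (1 : ℝ) / (m : ℝ) ^ n) a) :
    HasSum (fun m : ℕ => 1 / (2 * (m : ℝ) + 1) ^ n) (a - a / 2 ^ n) := by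
  have he : HasSum (fun m : ℕ => (1 : ℝ) / ((2 * m : ℕ) : ℝ) ^ n) (a / 2 ^ n) := by
    refine (h.div_const (2 ^ n)).congr_fun fun m => ?_
    push_cast
    rw [mul_pow, div_div, mul_comm]
  have ho : Summable fun m : ℕ => (1 : ℝ) / ((2 * m + 1 : ℕ) : ℝ) ^ n :=
    h.summable.comp_injective (i := fun m => 2 * m + 1) fun x y hxy => by
      simpa using hxy
  have := h.unique (HasSum.even_add_odd he ho.hasSum)
  have h2 : a - a / 2 ^ n = ∑' m : ℕ, (1 : ℝ) / ((2 * m + 1 : ℕ) : ℝ) ^ n := by linarith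
  rw [h2]
  exact_mod_cast ho.hasSum

theorem hasSum_one_div_odd_pow_two :
    HasSum (fun m : ℕ => 1 / (2 * (m : ℝ) + 1) ^ 2) (Real.pi ^ 2 / 8) := by
  convert hasSum_zeta_two.odd_of_one_div_pow using 1
  ring

theorem hasSum_one_div_odd_pow_four :
    HasSum (fun m : ℕ => 1 / (2 * (m : ℝ) + 1) ^ 4) (Real.pi ^ 4 / 96) := by
  convert hasSum_zeta_four.odd_of_one_div_pow using 1
  ring

theorem hasSum_neg_one_pow_div_odd_pow_three :
    HasSum (fun m : ℕ => (-1 : ℝ) ^ m / (2 * (m : ℝ) + 1) ^ 3) (Real.pi ^ 3 / 32) := by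
  have hi : Function.Injective fun m : ℕ => 2 * m + 1 := fun x y hxy => by simpa using hxy
  -- The factor sin(πn/2) in the L-series vanishes at even n and equals (-1)^m at n = 2m+1.
  refine ((hi.hasSum_iff fun n hn => ?_).2 hasSum_L_function_mod_four_eval_three).congr_fun
    fun m => ?_
  · have hn' : Even n := by
      by_contra h
      obtain ⟨m, rfl⟩ := Nat.not_even_iff_odd.1 h
      exact hn ⟨m, rfl⟩
    obtain ⟨m, rfl⟩ := hn'
    have : Real.pi * ((m + m : ℕ) : ℝ) / 2 = m * Real.pi := by push_cast; ring
    rw [this, Real.sin_nat_mul_pi, mul_zero]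
  · have : Real.pi * ((2 * m + 1 : ℕ) : ℝ) / 2 = Real.pi / 2 + m * Real.pi := by push_cast; ring
    simp only [Function.comp_apply]
    rw [this, Real.sin_add_nat_mul_pi, Real.sin_pi_div_two]
    push_cast
    ring

theorem hasSum_int_pow_two :
    HasSum (fun k : ℤ => 1 / (4 * (k : ℝ) + 1) ^ 2) (Real.pi ^ 2 / 8) := by
  rw [hasSum_one_div_four_mul_int_add_one_pow_iff]
  simpa using hasSum_one_div_odd_pow_two

theorem hasSum_int_pow_three :
    HasSum (fun k : ℤ => 1 / (4 * (k : ℝ) + 1) ^ 3) (Real.pi ^ 3 / 32) := by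
  rw [hasSum_one_div_four_mul_int_add_one_pow_iff]
  have h : (-1 : ℝ) ^ 3 = -1 := by norm_num
  simpa only [h] using hasSum_neg_one_pow_div_odd_pow_three

theorem hasSum_int_pow_four :
    HasSum (fun k : ℤ => 1 / (4 * (k : ℝ) + 1) ^ 4) (Real.pi ^ 4 / 96) := by
  rw [hasSum_one_div_four_mul_int_add_one_pow_iff]
  have h : (-1 : ℝ) ^ 4 = 1 := by norm_num
  simpa only [h, one_pow] using hasSum_one_div_odd_pow_four

/-! ### Eigenvalues and eigenfunctions of `opT` -/

/-- The eigenvalues of `opT`. -/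
noncomputable def eigenvalueT (k : ℤ) : ℝ := 2 / ((4 * (k : ℝ) + 1) * Real.pi)

theorem eigenvalueT_pow (k : ℤ) (n : ℕ) :
    eigenvalueT k ^ n = (2 / Real.pi) ^ n * (1 / (4 * (k : ℝ) + 1) ^ n) := by
  rw [eigenvalueT, mul_comm, div_mul_eq_div_div, div_pow, div_eq_mul_one_div]

theorem abs_eigenvalueT_le (k : ℤ) : |eigenvalueT k| ≤ 1 := by
  have h : (1 : ℝ) ≤ |4 * (k : ℝ) + 1| := by
    have h : (1 : ℤ) ≤ |4 * k + 1| := Int.one_le_abs (by omega)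
    exact_mod_cast h
  have hpi := Real.pi_gt_three
  rw [eigenvalueT, abs_div, abs_mul, abs_of_pos Real.pi_pos, div_le_one (by positivity), abs_two]
  nlinarith

/-- The value 1/2 is the area of the triangle s + t ≤ 1 in the unit square, hence the squared
Hilbert–Schmidt norm of `opT`; completeness rests on this equality. -/
theorem hasSum_eigenvalueT_sq : HasSum (fun k => eigenvalueT k ^ 2) (1 / 2) := by
  simp only [eigenvalueT_pow]
  have h : (1 : ℝ) / 2 = (2 / Real.pi) ^ 2 * (Real.pi ^ 2 / 8) := by
    have := Real.pi_ne_zero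
    field_simp
    norm_num
  rw [h]
  exact hasSum_int_pow_two.mul_left _

theorem summable_abs_eigenvalueT_pow {n : ℕ} (hn : 2 ≤ n) :
    Summable fun k => |eigenvalueT k ^ n| := by
  refine hasSum_eigenvalueT_sq.summable.of_nonneg_of_le (fun k => abs_nonneg _) fun k => ?_
  rw [abs_pow, ← sq_abs]
  exact pow_le_pow_of_le_one (abs_nonneg _) (abs_eigenvalueT_le k) hn

theorem integral_unitMeasure_eq (f : ℝ → ℝ) : ∫ t, f t ∂unitMeasure = ∫ t in (0 : ℝ)..1, f t := by
  rw [intervalIntegral.integral_of_le zero_le_one, integral_Ioc_eq_integral_Ioo]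

theorem ae_mem_Ioo_unitMeasure : ∀ᵐ t ∂unitMeasure, t ∈ Set.Ioo (0 : ℝ) 1 :=
  ae_restrict_mem measurableSet_Ioo

/-- The operator with kernel `K` integrates over `(0, 1 - t)`. -/
theorem kernelIntegral_eq (f : ℝ → ℝ) {t : ℝ} (ht : t ∈ Set.Icc (0 : ℝ) 1) :
    kernelIntegral f t = ∫ s in (0 : ℝ)..(1 - t), f s := by
  have h : (fun s => kernelK t s * f s) = (Set.Iic (1 - t)).indicator f := by
    funext s
    by_cases hs : s ≤ 1 - t
    · rw [Set.indicator_of_mem (Set.mem_Iic.2 hs), kernelK, if_pos (by linarith), one_mul]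
    · rw [Set.indicator_of_notMem (by simpa using hs), kernelK, if_neg (by linarith), zero_mul]
  rw [kernelIntegral, h, ← integral_Ioc_eq_integral_Ioo, integral_indicator measurableSet_Iic,
    Measure.restrict_restrict measurableSet_Iic, intervalIntegral.integral_of_le (by linarith [ht.2]),
    Set.inter_comm, Set.Ioc_inter_Iic, min_eq_right (by linarith [ht.1])]

/-- The eigenfunctions `√2 cos((4 k + 1) π t / 2)` of `opT`. -/
noncomputable def eigenfunT (k : ℤ) (t : ℝ) : ℝ :=
  √2 * Real.cos ((4 * (k : ℝ) + 1) * Real.pi / 2 * t)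

@[fun_prop]
theorem continuous_eigenfunT (k : ℤ) : Continuous (eigenfunT k) := by
  unfold eigenfunT
  fun_prop

theorem abs_eigenfunT_le (k : ℤ) (t : ℝ) : |eigenfunT k t| ≤ √2 := by
  rw [eigenfunT, abs_mul, abs_of_nonneg (Real.sqrt_nonneg 2)]
  exact mul_le_of_le_one_right (Real.sqrt_nonneg 2) (Real.abs_cos_le_one _)

theorem memLp_eigenfunT (k : ℤ) : MemLp (eigenfunT k) 2 unitMeasure :=
  MemLp.of_bound (continuous_eigenfunT k).aestronglyMeasurable √2
    (Filter.Eventually.of_forall fun t => abs_eigenfunT_le k t)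

theorem kernelIntegral_eigenfunT (k : ℤ) {t : ℝ} (ht : t ∈ Set.Icc (0 : ℝ) 1) :
    kernelIntegral (eigenfunT k) t = eigenvalueT k * eigenfunT k t := by
  have hpi := Real.pi_ne_zero
  have hk := four_mul_int_add_one_ne_zero k
  have h0 : (4 * (k : ℝ) + 1) * Real.pi / 2 ≠ 0 := by positivity
  rw [kernelIntegral_eq _ ht]
  simp only [eigenfunT]
  rw [intervalIntegral.integral_const_mul, intervalIntegral.integral_comp_mul_left _ h0,
    integral_cos, mul_zero, Real.sin_zero, sub_zero, eigenvalueT, smul_eq_mul]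
  -- Since ω = π/2 + 2πk, sin(ω(1 - t)) = cos(ωt); this is why only 4k+1 occurs, and not 4k+3.
  have h1 : (4 * (k : ℝ) + 1) * Real.pi / 2 * (1 - t) =
      Real.pi / 2 - (4 * (k : ℝ) + 1) * Real.pi / 2 * t + k * (2 * Real.pi) := by ring
  rw [h1, Real.sin_add_int_mul_two_pi, Real.sin_pi_div_two_sub, inv_div]
  ring

theorem integral_cos_int_mul_pi (m : ℤ) :
    ∫ t in (0 : ℝ)..1, Real.cos (m * Real.pi * t) = if m = 0 then 1 else 0 := by
  split_ifs with h
  · simp [h]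
  · have h0 : (m : ℝ) * Real.pi ≠ 0 := mul_ne_zero (by exact_mod_cast h) Real.pi_ne_zero
    rw [intervalIntegral.integral_comp_mul_left _ h0, integral_cos]
    simp [Real.sin_int_mul_pi]

theorem integral_eigenfunT_mul (j k : ℤ) :
    ∫ t, eigenfunT j t * eigenfunT k t ∂unitMeasure = if j = k then 1 else 0 := by
  have h : ∀ t, eigenfunT j t * eigenfunT k t =
      Real.cos ((2 * (j - k) : ℤ) * Real.pi * t) + Real.cos ((2 * (j + k) + 1 : ℤ) * Real.pi * t) :=
    fun t => by
      have h1 : ((2 * (j - k) : ℤ) : ℝ) * Real.pi * t = (4 * (j : ℝ) + 1) * Real.pi / 2 * t -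
        (4 * (k : ℝ) + 1) * Real.pi / 2 * t := by push_cast; ring
      have h2 : ((2 * (j + k) + 1 : ℤ) : ℝ) * Real.pi * t = (4 * (j : ℝ) + 1) * Real.pi / 2 * t +
        (4 * (k : ℝ) + 1) * Real.pi / 2 * t := by push_cast; ring
      rw [h1, h2, Real.cos_sub, Real.cos_add, eigenfunT, eigenfunT, mul_mul_mul_comm,
        Real.mul_self_sqrt zero_le_two]
      ring
  simp only [h]
  rw [integral_unitMeasure_eq, intervalIntegral.integral_add
    (Continuous.intervalIntegrable (by fun_prop) _ _)
    (Continuous.intervalIntegrable (by fun_prop) _ _), integral_cos_int_mul_pi,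
    integral_cos_int_mul_pi, if_neg (by omega : ¬ 2 * (j + k) + 1 = 0), add_zero]
  exact if_congr (by omega) rfl rfl

theorem inner_toLp_left {f : ℝ → ℝ} (hf : MemLp f 2 unitMeasure) (g : L2Unit) :
    inner ℝ (hf.toLp f) g = ∫ t, f t * g t ∂unitMeasure := by
  rw [L2.inner_def]
  refine integral_congr_ae ?_
  filter_upwards [hf.coeFn_toLp] with t ht
  rw [ht, real_inner_eq_re_inner, RCLike.inner_apply]
  simp [mul_comm]

theorem inner_toLp_toLp {f g : ℝ → ℝ} (hf : MemLp f 2 unitMeasure) (hg : MemLp g 2 unitMeasure) :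
    inner ℝ (hf.toLp f) (hg.toLp g) = ∫ t, f t * g t ∂unitMeasure := by
  rw [inner_toLp_left]
  refine integral_congr_ae ?_
  filter_upwards [hg.coeFn_toLp] with t ht
  rw [ht]

/-- The eigenfunctions of `opT` as elements of `L²(0, 1)`. -/
noncomputable def eigenvectorT (k : ℤ) : L2Unit := (memLp_eigenfunT k).toLp (eigenfunT k)

theorem orthonormal_eigenvectorT : Orthonormal ℝ eigenvectorT := by
  rw [orthonormal_iff_ite]
  intro j k
  rw [eigenvectorT, eigenvectorT, inner_toLp_toLp, integral_eigenfunT_mul]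

theorem opT_eigenvectorT (k : ℤ) : opT (eigenvectorT k) = eigenvalueT k • eigenvectorT k := by
  refine Lp.ext ?_
  filter_upwards [opT_apply_ae (eigenvectorT k), Lp.coeFn_smul (eigenvalueT k) (eigenvectorT k),
    (memLp_eigenfunT k).coeFn_toLp, ae_mem_Ioo_unitMeasure] with t h1 h2 h3 ht
  rw [h1, h2, Pi.smul_apply, eigenvectorT, h3, smul_eq_mul,
    ← kernelIntegral_eigenfunT k (Set.Ioo_subset_Icc_self ht)]
  exact congrFun (kernelIntegral_congr (memLp_eigenfunT k).coeFn_toLp) t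

theorem opT_pow_eigenvectorT (n : ℕ) (k : ℤ) :
    (opT ^ n) (eigenvectorT k) = eigenvalueT k ^ n • eigenvectorT k := by
  induction n with
  | zero => simp
  | succ n ih =>
    rw [pow_succ]
    change (opT ^ n) (opT (eigenvectorT k)) = _
    rw [opT_eigenvectorT, map_smul, ih, smul_smul, pow_succ']

/-! ### Completeness of the eigenfunctions -/

theorem memLp_kernelK (t : ℝ) : MemLp (kernelK t) 2 unitMeasure :=
  MemLp.of_bound (measurable_kernelK.comp measurable_prodMk_left).aestronglyMeasurable 1
    (Filter.Eventually.of_forall fun s => abs_kernelK_le t s)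

/-- The section `K(t, ·)` of the kernel as an element of `L²(0, 1)`. -/
noncomputable def kernelSection (t : ℝ) : L2Unit := (memLp_kernelK t).toLp (kernelK t)

theorem inner_kernelSection (t : ℝ) (g : L2Unit) :
    inner ℝ (kernelSection t) g = kernelIntegral g t :=
  inner_toLp_left _ g

theorem inner_kernelSection_eigenvectorT (k : ℤ) {t : ℝ} (ht : t ∈ Set.Icc (0 : ℝ) 1) :
    inner ℝ (kernelSection t) (eigenvectorT k) = eigenvalueT k * eigenfunT k t := by
  rw [← kernelIntegral_eigenfunT k ht]
  exact inner_toLp_toLp _ _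

theorem norm_kernelSection_sq {t : ℝ} (ht : t ∈ Set.Icc (0 : ℝ) 1) :
    ‖kernelSection t‖ ^ 2 = 1 - t := by
  have h : ∀ s, kernelK t s * kernelK t s = kernelK t s * 1 := fun s => by
    unfold kernelK; split_ifs <;> simp
  rw [← real_inner_self_eq_norm_sq, kernelSection, inner_toLp_toLp]
  simp only [h]
  have := kernelIntegral_eq (fun _ => 1) ht
  simpa [kernelIntegral] using this

/-- If Tg = 0, the primitive of g vanishes almost everywhere, hence on all of (0, 1) by continuity;
Lebesgue differentiation gives g = 0. -/
theorem eq_zero_of_opT_eq_zero {g : L2Unit} (hg : opT g = 0) : g = 0 := by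
  have hint : IntervalIntegrable (g : ℝ → ℝ) volume 0 1 := by
    rw [intervalIntegrable_iff_integrableOn_Ioo_of_le zero_le_one]
    exact integrable_coe g
  have h1 : ∀ᵐ t ∂unitMeasure, ∫ s in (0 : ℝ)..(1 - t), g s = 0 := by
    have h0 : ∀ᵐ t ∂unitMeasure, opT g t = 0 := by
      rw [hg]
      exact Lp.coeFn_zero ℝ 2 unitMeasure
    filter_upwards [opT_apply_ae g, h0, ae_mem_Ioo_unitMeasure] with t h1 h2 ht
    rw [← kernelIntegral_eq _ (Set.Ioo_subset_Icc_self ht)]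
    exact h1.symm.trans h2
  have hcont : ContinuousOn (fun x => ∫ s in (0 : ℝ)..x, g s) (Set.Icc 0 1) := by
    have := intervalIntegral.continuousOn_primitive_interval' hint (Set.left_mem_uIcc)
    rwa [Set.uIcc_of_le zero_le_one] at this
  have h2 : Set.EqOn (fun t => ∫ s in (0 : ℝ)..(1 - t), g s) (fun _ => 0) (Set.Ioo 0 1) := by
    refine Measure.eqOn_open_of_ae_eq h1 isOpen_Ioo ?_ continuousOn_const
    exact hcont.comp (by fun_prop) fun t ht => ⟨by linarith [ht.2], by linarith [ht.1]⟩
  have h3 : ∀ x ∈ Set.Ioo (0 : ℝ) 1, ∫ s in (0 : ℝ)..x, g s = 0 := fun x hx => by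
    have := h2 (x := 1 - x) ⟨by linarith [hx.2], by linarith [hx.1]⟩
    simpa using this
  refine Lp.ext ?_
  filter_upwards [ae_restrict_of_ae hint.ae_hasDerivAt_integral, ae_mem_Ioo_unitMeasure,
    Lp.coeFn_zero ℝ 2 unitMeasure] with x hx hx1 hx0
  have hd := hx (by rw [Set.uIcc_of_le zero_le_one]; exact Set.Ioo_subset_Icc_self hx1) 0
    Set.left_mem_uIcc
  rw [hx0]
  refine hd.unique ((hasDerivAt_const x (0 : ℝ)).congr_of_eventuallyEq ?_)
  filter_upwards [isOpen_Ioo.mem_nhds hx1] with y hy using h3 y hy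

/-- Bessel's inequality for K(t, ·) against the eigenfunctions together with g, integrated over t;
the right side is ∫ (1 - t) dt. -/
theorem sum_eigenvalueT_sq_le {g : L2Unit} (hg : ‖g‖ = 1)
    (horth : ∀ k, inner ℝ (eigenvectorT k) g = 0) (s : Finset ℤ) :
    ∑ k ∈ s, eigenvalueT k ^ 2 + ‖opT g‖ ^ 2 ≤ 1 / 2 := by
  have hpt : ∀ t ∈ Set.Icc (0 : ℝ) 1,
      ∑ k ∈ s, eigenvalueT k ^ 2 * (eigenfunT k t * eigenfunT k t) +
        kernelIntegral g t * kernelIntegral g t ≤ 1 - t := fun t ht => by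
    -- Removing the component along g leaves the coefficients at the eigenvectors unchanged and
    -- lowers the squared norm by (Tg)(t)².
    have hb := orthonormal_eigenvectorT.sum_inner_products_le (s := s)
      (kernelSection t - kernelIntegral g t • g)
    have hk : ∀ k, ‖inner ℝ (eigenvectorT k) (kernelSection t - kernelIntegral g t • g)‖ ^ 2 =
        eigenvalueT k ^ 2 * (eigenfunT k t * eigenfunT k t) := fun k => by
      rw [inner_sub_right, inner_smul_right, horth, mul_zero, sub_zero, real_inner_comm,
        inner_kernelSection_eigenvectorT k ht, Real.norm_eq_abs, sq_abs]
      ring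
    have hr : ‖kernelSection t - kernelIntegral g t • g‖ ^ 2 =
        1 - t - kernelIntegral g t * kernelIntegral g t := by
      rw [norm_sub_sq_real, norm_kernelSection_sq ht, inner_smul_right, inner_kernelSection,
        norm_smul, hg, mul_one, Real.norm_eq_abs, sq_abs]
      ring
    simp only [hk, hr] at hb
    linarith
  have hi : ∀ k ∈ s, Integrable
      (fun t => eigenvalueT k ^ 2 * (eigenfunT k t * eigenfunT k t)) unitMeasure := fun k _ =>
    ((memLp_eigenfunT k).integrable_mul (memLp_eigenfunT k)).const_mul _
  have hT := (memLp_kernelIntegral g).integrable_mul (memLp_kernelIntegral g)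
  have hT' : ∫ t, kernelIntegral g t * kernelIntegral g t ∂unitMeasure = ‖opT g‖ ^ 2 := by
    rw [← real_inner_self_eq_norm_sq]
    exact (inner_toLp_toLp (memLp_kernelIntegral g) (memLp_kernelIntegral g)).symm
  have hmono := integral_mono_ae ((integrable_finsetSum s hi).add hT)
    (g := fun t => 1 - t) ?_ (ae_mem_Ioo_unitMeasure.mono fun t ht =>
      (by simpa using hpt t (Set.Ioo_subset_Icc_self ht)))
  · rw [integral_add' (integrable_finsetSum s hi) hT, integral_finsetSum s hi] at hmono
    simp only [integral_const_mul, integral_eigenfunT_mul, if_true, mul_one, Pi.mul_apply, hT']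
      at hmono
    refine hmono.trans_eq ?_
    rw [integral_unitMeasure_eq, intervalIntegral.integral_sub
      (Continuous.intervalIntegrable (by fun_prop) _ _)
      (Continuous.intervalIntegrable (by fun_prop) _ _), integral_id]
    norm_num
  · exact (Continuous.integrableOn_Icc (by fun_prop)).mono_set Set.Ioo_subset_Icc_self

theorem span_eigenvectorT_orthogonal :
    (Submodule.span ℝ (Set.range eigenvectorT))ᗮ = ⊥ := by
  rw [Submodule.eq_bot_iff]
  intro g hg
  by_contra hne
  have hn : ‖g‖ ≠ 0 := norm_ne_zero_iff.2 hne
  have hort : ∀ k, inner ℝ (eigenvectorT k) (‖g‖⁻¹ • g) = 0 := fun k => by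
    rw [inner_smul_right, (Submodule.mem_orthogonal _ g).1 hg _ (Submodule.subset_span ⟨k, rfl⟩),
      mul_zero]
  have h1 : ‖‖g‖⁻¹ • g‖ = 1 := by rw [norm_smul, norm_inv, norm_norm, inv_mul_cancel₀ hn]
  have h2 : 1 / 2 ≤ 1 / 2 - ‖opT (‖g‖⁻¹ • g)‖ ^ 2 :=
    hasSum_le_of_sum_le hasSum_eigenvalueT_sq fun s => by
      linarith [sum_eigenvalueT_sq_le h1 hort s]
  have h3 : opT (‖g‖⁻¹ • g) = 0 := by
    rw [← norm_eq_zero, ← sq_eq_zero_iff]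
    exact le_antisymm (by linarith) (sq_nonneg _)
  have h4 := eq_zero_of_opT_eq_zero h3
  rw [h4, norm_zero] at h1
  exact zero_ne_one h1

/-- The orthonormal basis of eigenfunctions of `opT`. -/
noncomputable def eigenbasisT : HilbertBasis ℤ ℝ L2Unit :=
  HilbertBasis.mkOfOrthogonalEqBot orthonormal_eigenvectorT span_eigenvectorT_orthogonal

theorem eigenbasisT_apply (k : ℤ) : eigenbasisT k = eigenvectorT k :=
  congrFun (HilbertBasis.coe_mkOfOrthogonalEqBot _ _) k

/-! ### Iterated kernels and their diagonal integrals -/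

/-- The kernels of the powers of `opT`: `iteratedKernel m` is the kernel of `opT ^ (m + 1)`. -/
noncomputable def iteratedKernel : ℕ → ℝ → ℝ → ℝ
  | 0 => kernelK
  | m + 1 => fun s t => kernelIntegral (fun u => iteratedKernel m u t) s

theorem kernelK_comm (s t : ℝ) : kernelK s t = kernelK t s := by
  rw [kernelK, kernelK, add_comm]

theorem abs_eigenvalueT_pow_mul_le (k : ℤ) (n : ℕ) (s t : ℝ) :
    |eigenvalueT k ^ n * (eigenfunT k s * eigenfunT k t)| ≤ |eigenvalueT k ^ n| * 2 := by
  rw [abs_mul, abs_mul]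
  refine mul_le_mul_of_nonneg_left ?_ (abs_nonneg _)
  calc |eigenfunT k s| * |eigenfunT k t| ≤ √2 * √2 :=
        mul_le_mul (abs_eigenfunT_le k s) (abs_eigenfunT_le k t) (abs_nonneg _) (Real.sqrt_nonneg _)
    _ = 2 := Real.mul_self_sqrt zero_le_two

theorem hasSum_integral_of_summable_bound {F : ℤ → ℝ → ℝ} {f : ℝ → ℝ} {c : ℤ → ℝ}
    (hc : Summable c) (hF : ∀ k, AEStronglyMeasurable (F k) unitMeasure)
    (hb : ∀ k t, |F k t| ≤ c k) (hf : ∀ t ∈ Set.Ioo (0 : ℝ) 1, HasSum (F · t) (f t)) :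
    HasSum (fun k => ∫ t, F k t ∂unitMeasure) (∫ t, f t ∂unitMeasure) :=
  hasSum_integral_of_dominated_convergence (fun k _ => c k) hF
    (fun k => Filter.Eventually.of_forall (hb k)) (Filter.Eventually.of_forall fun _ => hc)
    (integrable_const _) (ae_mem_Ioo_unitMeasure.mono hf)

/-- The eigenfunction expansion of the iterated kernels. -/
theorem hasSum_iteratedKernel (m : ℕ) {s t : ℝ} (hs : s ∈ Set.Icc (0 : ℝ) 1)
    (ht : t ∈ Set.Icc (0 : ℝ) 1) :
    HasSum (fun k => eigenvalueT k ^ (m + 2) * (eigenfunT k s * eigenfunT k t))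
      (iteratedKernel (m + 1) s t) := by
  induction m generalizing s with
  | zero =>
    -- Parseval for two sections of K holds at every s and t, not just almost everywhere; this
    -- matters because the diagonal is a null set.
    have h := eigenbasisT.hasSum_inner_mul_inner (kernelSection s) (kernelSection t)
    have he : inner ℝ (kernelSection s) (kernelSection t) = iteratedKernel (0 + 1) s t := by
      rw [kernelSection, kernelSection, inner_toLp_toLp]
      simp only [iteratedKernel, kernelIntegral, kernelK_comm t]
    rw [he] at h
    refine h.congr_fun fun k => ?_
    rw [eigenbasisT_apply, inner_kernelSection_eigenvectorT k hs, real_inner_comm,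
      inner_kernelSection_eigenvectorT k ht]
    ring
  | succ m ih =>
    -- Integrating the expansion against K(s, ·) term by term multiplies each term by one more
    -- eigenvalue.
    have h := hasSum_integral_of_summable_bound
      (F := fun k u => kernelK s u * (eigenvalueT k ^ (m + 2) * (eigenfunT k u * eigenfunT k t)))
      (f := fun u => kernelK s u * iteratedKernel (m + 1) u t)
      ((summable_abs_eigenvalueT_pow (n := m + 2) (by omega)).mul_right 2) (fun k => ?_)
      (fun k u => ?_) fun u hu => (ih (Set.Ioo_subset_Icc_self hu)).mul_left _
    · refine h.congr_fun fun k => ?_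
      have hk : ∀ u, kernelK s u * (eigenvalueT k ^ (m + 2) * (eigenfunT k u * eigenfunT k t)) =
          kernelK s u * eigenfunT k u * (eigenvalueT k ^ (m + 2) * eigenfunT k t) :=
        fun u => by ring
      simp only [hk]
      rw [integral_mul_const]
      have := kernelIntegral_eigenfunT k hs
      rw [kernelIntegral] at this
      rw [this]
      ring
    · exact (memLp_kernelK s).1.mul (Continuous.aestronglyMeasurable (by fun_prop))
    · rw [abs_mul]
      exact (mul_le_of_le_one_left (abs_nonneg _) (abs_kernelK_le s u)).trans
        (abs_eigenvalueT_pow_mul_le k _ u t)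

theorem hasSum_eigenvalueT_pow (m : ℕ) :
    HasSum (fun k => eigenvalueT k ^ (m + 2)) (∫ u, iteratedKernel (m + 1) u u ∂unitMeasure) := by
  have h := hasSum_integral_of_summable_bound
    (F := fun k u => eigenvalueT k ^ (m + 2) * (eigenfunT k u * eigenfunT k u))
    ((summable_abs_eigenvalueT_pow (n := m + 2) (by omega)).mul_right 2)
    (fun k => Continuous.aestronglyMeasurable (by fun_prop))
    (fun k u => abs_eigenvalueT_pow_mul_le k _ u u) fun u hu =>
      hasSum_iteratedKernel m (Set.Ioo_subset_Icc_self hu) (Set.Ioo_subset_Icc_self hu)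
  simpa only [integral_const_mul, integral_eigenfunT_mul, if_true, mul_one] using h

/-! ### Cycle volumes as integrals over closed paths -/

/-- The indicator of the condition that consecutive entries of `s, x 0, …, x (m - 1), t` have sum
at most `1`. -/
noncomputable def pathWeight {m : ℕ} (s : ℝ) (x : Fin m → ℝ) (t : ℝ) : ℝ :=
  if ∀ i : Fin (m + 1), (Fin.cons s x : Fin (m + 1) → ℝ) i + (Fin.snoc x t : Fin (m + 1) → ℝ) i ≤ 1
  then 1 else 0

theorem pathWeight_zero (s : ℝ) (x : Fin 0 → ℝ) (t : ℝ) : pathWeight s x t = kernelK s t := by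
  simp [pathWeight, kernelK, Fin.forall_fin_one, Fin.snoc]

/-- Splitting off the first edge matches the recursion of `iteratedKernel` under Fubini. -/
theorem pathWeight_cons {m : ℕ} (s u : ℝ) (x : Fin m → ℝ) (t : ℝ) :
    pathWeight s (Fin.cons u x : Fin (m + 1) → ℝ) t = kernelK s u * pathWeight u x t := by
  have h : (∀ i : Fin (m + 2), (Fin.cons s (Fin.cons u x : Fin (m + 1) → ℝ) : Fin (m + 2) → ℝ) i +
      (Fin.snoc (Fin.cons u x : Fin (m + 1) → ℝ) t : Fin (m + 2) → ℝ) i ≤ 1) ↔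
      s + u ≤ 1 ∧ ∀ i : Fin (m + 1), (Fin.cons u x : Fin (m + 1) → ℝ) i +
        (Fin.snoc x t : Fin (m + 1) → ℝ) i ≤ 1 := by
    rw [Fin.forall_fin_succ, ← Fin.cons_snoc_eq_snoc_cons]
    simp only [Fin.cons_zero, Fin.cons_succ]
  simp only [pathWeight, h, kernelK, ite_and, ite_mul, one_mul, zero_mul]

theorem abs_pathWeight_le {m : ℕ} (s : ℝ) (x : Fin m → ℝ) (t : ℝ) : |pathWeight s x t| ≤ 1 := by
  unfold pathWeight
  split_ifs <;> simp

theorem measurable_pathWeight {α : Type*} [MeasurableSpace α] {m : ℕ} {s t : α → ℝ}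
    {x : α → Fin m → ℝ} (hs : Measurable s) (hx : Measurable x) (ht : Measurable t) :
    Measurable fun a => pathWeight (s a) (x a) (t a) := by
  have hx' : ∀ j, Measurable fun a => x a j := measurable_pi_iff.1 hx
  refine Measurable.ite ?_ measurable_const measurable_const
  rw [Set.ofPred_forall]
  refine MeasurableSet.iInter fun i => measurableSet_le (Measurable.add ?_ ?_) measurable_const
  · refine Fin.cases ?_ (fun j => ?_) i
    · simpa using hs
    · simpa using hx' j
  · refine Fin.lastCases ?_ (fun j => ?_) i
    · simpa using ht
    · simpa using hx' j

theorem integral_pi_unitMeasure_succ {m : ℕ} {f : (Fin (m + 1) → ℝ) → ℝ} (hf : Measurable f)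
    (hb : ∀ x, |f x| ≤ 1) :
    ∫ x, f x ∂Measure.pi (fun _ => unitMeasure) =
      ∫ u, ∫ y, f (Fin.cons u y) ∂Measure.pi (fun _ => unitMeasure) ∂unitMeasure := by
  have h := (measurePreserving_piFinSuccAbove (fun _ : Fin (m + 1) => unitMeasure) 0).symm
  rw [← h.integral_comp', integral_prod]
  · have hc : ∀ (u : ℝ) (y : Fin m → ℝ), Fin.insertNthEquiv (fun _ => ℝ) 0 (u, y) = Fin.cons u y :=
      fun u y => Fin.insertNth_zero' u y
    simp only [MeasurableEquiv.piFinSuccAbove_symm_apply, hc]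
  · exact Integrable.of_bound (hf.comp (MeasurableEquiv.measurable _)).aestronglyMeasurable 1
      (Filter.Eventually.of_forall fun p => hb _)

theorem integral_pathWeight (m : ℕ) (s t : ℝ) :
    ∫ x : Fin m → ℝ, pathWeight s x t ∂Measure.pi (fun _ => unitMeasure) =
      iteratedKernel m s t := by
  induction m generalizing s with
  | zero => simp [pathWeight_zero, iteratedKernel]
  | succ m ih =>
    rw [integral_pi_unitMeasure_succ (f := fun x => pathWeight s x t)
      (measurable_pathWeight measurable_const measurable_id measurable_const)
      fun x => abs_pathWeight_le s x t]
    simp only [pathWeight_cons, integral_const_mul, ih, iteratedKernel, kernelIntegral]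

theorem pi_unitMeasure (m : ℕ) : Measure.pi (fun _ : Fin m => unitMeasure) =
    volume.restrict (Set.univ.pi fun _ : Fin m => Set.Icc (0 : ℝ) 1) := by
  rw [volume_pi, Measure.restrict_pi_pi, unitMeasure, restrict_Ioo_eq_restrict_Icc]

theorem graphPolytope_cycleGraph (m : ℕ) : graphPolytope (SimpleGraph.cycleGraph (m + 2)) =
    {x | ∀ i, x i + x (i + 1) ≤ 1} ∩ Set.univ.pi fun _ => Set.Icc (0 : ℝ) 1 := by
  ext x
  simp only [graphPolytope, SimpleGraph.cycleGraph_adj, Set.mem_ofPred_eq, Set.mem_inter_iff,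
    Set.mem_univ_pi]
  rw [and_comm]
  -- Addition in `Fin (m + 2)` is cyclic, so i ↦ i + 1 runs over all edges; for m = 0 it meets the
  -- single edge twice.
  refine and_congr_left fun _ => ⟨fun h i => h i (i + 1) (Or.inr (by simp)), ?_⟩
  rintro h i j (hij | hij)
  · rw [sub_eq_iff_eq_add'.1 hij, add_comm]
    exact h j
  · rw [sub_eq_iff_eq_add'.1 hij]
    exact h i

/-- A path that starts and ends at `x 0` is a cycle: the last index plus one wraps round to 0. -/
theorem pathWeight_tail {m : ℕ} (x : Fin (m + 1) → ℝ) : pathWeight (x 0) (Fin.tail x) (x 0) =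
    {x : Fin (m + 1) → ℝ | ∀ i, x i + x (i + 1) ≤ 1}.indicator 1 x := by
  have h : ∀ i, (Fin.snoc (Fin.tail x) (x 0) : Fin (m + 1) → ℝ) i = x (i + 1) := fun i => by
    refine Fin.lastCases ?_ (fun j => ?_) i
    · simp
    · simp [Fin.tail]
  simp only [pathWeight, Fin.cons_self_tail, h, Set.indicator, Set.mem_ofPred_eq, Pi.one_apply]

theorem graphVolume_cycleGraph (m : ℕ) : graphVolume (SimpleGraph.cycleGraph (m + 2)) =
    ∫ u, iteratedKernel (m + 1) u u ∂unitMeasure := by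
  have hs : MeasurableSet {x : Fin (m + 2) → ℝ | ∀ i, x i + x (i + 1) ≤ 1} := by
    rw [Set.ofPred_forall]
    exact MeasurableSet.iInter fun i => measurableSet_le (by fun_prop) measurable_const
  have hw : Measurable fun x : Fin (m + 2) → ℝ => pathWeight (x 0) (Fin.tail x) (x 0) :=
    measurable_pathWeight (by fun_prop) (measurable_pi_iff.2 fun i => measurable_pi_apply _)
      (by fun_prop)
  rw [graphVolume, graphPolytope_cycleGraph, ← measureReal_restrict_apply hs, ← pi_unitMeasure,
    ← integral_indicator_one hs]
  simp only [← pathWeight_tail]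
  rw [integral_pi_unitMeasure_succ hw fun x => abs_pathWeight_le _ _ _]
  simp only [Fin.cons_zero, Fin.tail_cons, integral_pathWeight]

/-! ### Trace formula, series and the cases n = 3, 4 -/

theorem hasSum_eigenvalueT_pow_graphVolume {n : ℕ} (hn : 2 ≤ n) :
    HasSum (fun k => eigenvalueT k ^ n) (graphVolume (SimpleGraph.cycleGraph n)) := by
  obtain ⟨m, rfl⟩ := Nat.exists_eq_add_of_le' hn
  rw [graphVolume_cycleGraph]
  exact hasSum_eigenvalueT_pow m

theorem hasTrace_opT_pow {n : ℕ} (hn : 2 ≤ n) :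
    HasTrace (opT ^ n) (graphVolume (SimpleGraph.cycleGraph n)) :=
  eigenbasisT.hasTrace_of_eigen (c := fun k => eigenvalueT k ^ n)
    (fun k => by rw [eigenbasisT_apply, opT_pow_eigenvectorT]) (summable_abs_eigenvalueT_pow hn)
    (hasSum_eigenvalueT_pow_graphVolume hn)

theorem hasSum_int_pow_graphVolume {n : ℕ} (hn : 2 ≤ n) :
    HasSum (fun k : ℤ => 1 / (4 * (k : ℝ) + 1) ^ n)
      (Real.pi ^ n * graphVolume (SimpleGraph.cycleGraph n) / 2 ^ n) := by
  have hpi := Real.pi_ne_zero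
  have h := (hasSum_eigenvalueT_pow_graphVolume hn).mul_left ((Real.pi / 2) ^ n)
  have hv : (Real.pi / 2) ^ n * graphVolume (SimpleGraph.cycleGraph n) =
      Real.pi ^ n * graphVolume (SimpleGraph.cycleGraph n) / 2 ^ n := by
    rw [div_pow]
    ring
  rw [hv] at h
  refine h.congr_fun fun k => ?_
  rw [eigenvalueT_pow, ← mul_assoc, ← mul_pow, div_mul_div_cancel₀ two_ne_zero, div_self hpi,
    one_pow, one_mul]

theorem graphVolume_cycleGraph_three : graphVolume (SimpleGraph.cycleGraph 3) = 1 / 4 := by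
  have h := (hasSum_int_pow_graphVolume (n := 3) (by norm_num)).unique hasSum_int_pow_three
  have hpi := pow_ne_zero 3 Real.pi_ne_zero
  refine mul_left_cancel₀ hpi ?_
  linarith

theorem graphVolume_cycleGraph_four : graphVolume (SimpleGraph.cycleGraph 4) = 1 / 6 := by
  have h := (hasSum_int_pow_graphVolume (n := 4) (by norm_num)).unique hasSum_int_pow_four
  have hpi := pow_ne_zero 4 Real.pi_ne_zero
  refine mul_left_cancel₀ hpi ?_
  linarith

theorem mainTheorem4 :
    (∀ n : ℕ, 2 ≤ n →
      HasTrace (opT ^ n) (graphVolume (SimpleGraph.cycleGraph n)) ∧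
      HasSum (fun k : ℤ => 1 / (4 * (k : ℝ) + 1) ^ n)
        (Real.pi ^ n * graphVolume (SimpleGraph.cycleGraph n) / 2 ^ n)) ∧
    (graphVolume (SimpleGraph.cycleGraph 3) = 1 / 4 ∧
      HasSum (fun k : ℤ => 1 / (4 * (k : ℝ) + 1) ^ 3) (Real.pi ^ 3 / 32) ∧
      HasSum (fun m : ℕ => (-1 : ℝ) ^ m / (2 * (m : ℝ) + 1) ^ 3) (Real.pi ^ 3 / 32)) ∧
    (graphVolume (SimpleGraph.cycleGraph 4) = 1 / 6 ∧
      HasSum (fun k : ℤ => 1 / (4 * (k : ℝ) + 1) ^ 4) (Real.pi ^ 4 / 96) ∧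
      HasSum (fun m : ℕ => 1 / (2 * (m : ℝ) + 1) ^ 4) (Real.pi ^ 4 / 96)) :=
  ⟨fun _ hn => ⟨hasTrace_opT_pow hn, hasSum_int_pow_graphVolume hn⟩,
    ⟨graphVolume_cycleGraph_three, hasSum_int_pow_three, hasSum_neg_one_pow_div_odd_pow_three⟩,
    ⟨graphVolume_cycleGraph_four, hasSum_int_pow_four, hasSum_one_div_odd_pow_four⟩⟩
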